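/- All manifolds are compact topological manifolds, possibly with boundary, possibly disconnected and not necessarily orientable. A Seifert manifold is a compact $3$-manifold $N$ for which there is a continuous map $p\colon N\to F$ onto a compact surface $F$ such that, away from finitely many points of $F$, $p$ is a locally trivial bundle with fibre the circle $S^1$, and near each of these finitely many points $p$ is a fibred solid torus, i.e. for some coprime integers $\alpha\ge 1$ and $\nu$ it is, in suitable coordinates centred at the point, the map $\mathbb{C}\times S^1\to\mathbb{C}$, $(z,w)\mapsto z^{\alpha}w^{\nu}$. A Waldhausen manifold is a compact $3$-manifold obtained from finitely many connected Seifert manifolds by gluing some pairs of distinct boundary components that are tori, each boundary component occurring in at most one pair, by homeomorphisms. Let $M$ be a Waldhausen manifold and let $\pi\colon M'\to M$ be a finite covering, i.e. an unramified covering map all of whose fibres are finite (the covering need not be a normal one, so all finite regular coverings are included). Then $M'$ is a Waldhausen manifold. -/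

import Mathlib

universe u

namespace ThreeManifold

/-- `X` is a topological `n`-manifold with (possibly empty) boundary: Hausdorff, second countable
and locally homeomorphic to open subsets of the closed half-space of dimension `n`.
Connectedness is not required. -/
structure IsTopologicalManifold (n : ℕ) [NeZero n] (X : Type u) [TopologicalSpace X] : Prop where
  t2 : T2Space X
  secondCountable : SecondCountableTopology X
  exists_chart : ∀ x : X, ∃ e : OpenPartialHomeomorph X (EuclideanHalfSpace n), x ∈ e.source

/-- The boundary of an `n`-manifold: the points that have no open neighbourhood homeomorphic to an
open subset of `ℝⁿ`. -/
def manifoldBoundary (n : ℕ) (X : Type u) [TopologicalSpace X] : Set X :=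
  {x | ¬ ∃ e : OpenPartialHomeomorph X (EuclideanSpace ℝ (Fin n)), x ∈ e.source}

/-- The projection of the (open) fibred solid torus with invariants `(α, ν)`, where `α ≥ 1` and
`ν` is coprime to `α`, onto its orbit space `ℂ`. Its fibres are exactly the orbits of the circle
action `t • (z, w) = (t ^ (-ν) * z, t ^ α * w)` on `ℂ × S¹`; the core `z = 0` is a fibre of
multiplicity `α`. -/
noncomputable def fibredSolidTorusProj (α : ℕ) (ν : ℤ) (x : ℂ × Circle) : ℂ :=
  x.1 ^ α * ((x.2 ^ ν : Circle) : ℂ)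

/-- Near the fibre over `b`, the map `p` is a fibred solid torus with the fibre over `b` as its
core. -/
def IsFibredSolidTorusAt {N F : Type u} [TopologicalSpace N] [TopologicalSpace F]
    (p : N → F) (b : F) : Prop :=
  ∃ (α : ℕ) (ν : ℤ), 0 < α ∧ IsCoprime (α : ℤ) ν ∧
    ∃ (U : Set F) (hb : b ∈ U) (g : U ≃ₜ ℂ) (h : (p ⁻¹' U) ≃ₜ ℂ × Circle),
      IsOpen U ∧ g ⟨b, hb⟩ = 0 ∧
        ∀ x : p ⁻¹' U, g ⟨p x.1, x.2⟩ = fibredSolidTorusProj α ν (h x)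

/-- `p : N → F` is a Seifert fibration of the compact `3`-manifold `N` over the compact surface
`F`: away from finitely many points of the base it is a locally trivial bundle with fibre the
circle, and near each of these points it is a fibred solid torus (so that these points lie in the
interior of `F`). Both `N` and `F` may have boundary. -/
structure IsSeifertFibration {N F : Type u} [TopologicalSpace N] [TopologicalSpace F]
    (p : N → F) : Prop where
  manifold_total : IsTopologicalManifold 3 N
  compact_total : CompactSpace N
  manifold_base : IsTopologicalManifold 2 F
  compact_base : CompactSpace F
  continuous_proj : Continuous p
  exists_special : ∃ E : Set F, E.Finite ∧
    (∀ b ∉ E, ∃ e : Bundle.Trivialization Circle p, b ∈ e.baseSet) ∧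
    ∀ b ∈ E, IsFibredSolidTorusAt p b

/-- A Seifert manifold: a compact `3`-manifold that admits a Seifert fibration over a compact
surface. It may be disconnected, i.e. a finite disjoint union of connected Seifert manifolds. -/
def IsSeifertManifold (N : Type u) [TopologicalSpace N] : Prop :=
  ∃ (F : Type u) (_ : TopologicalSpace F) (p : N → F), IsSeifertFibration p

/-- `T` is a connected component of the boundary of the `3`-manifold `N`, and a torus. -/
def IsBoundaryTorus {N : Type u} [TopologicalSpace N] (T : Set N) : Prop :=
  (∃ x ∈ manifoldBoundary 3 N, T = connectedComponentIn (manifoldBoundary 3 N) x) ∧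
    Nonempty (T ≃ₜ Circle × Circle)

/-- Gluing data on a `3`-manifold `N`: finitely many pairs of boundary tori of `N`, all of them
pairwise disjoint, and for each pair a homeomorphism between its two members. -/
structure TorusGluing (N : Type u) [TopologicalSpace N] where
  numPairs : ℕ
  left : Fin numPairs → Set N
  right : Fin numPairs → Set N
  isBoundaryTorus_left : ∀ i, IsBoundaryTorus (left i)
  isBoundaryTorus_right : ∀ i, IsBoundaryTorus (right i)
  pairwise_disjoint : Pairwise fun a b : Fin numPairs ⊕ Fin numPairs =>
    Disjoint (Sum.elim left right a) (Sum.elim left right b)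
  glue : ∀ i, left i ≃ₜ right i

/-- The equivalence relation generated by the gluing: two points are identified if they are equal
or correspond to each other under one of the gluing homeomorphisms. -/
def TorusGluing.Rel {N : Type u} [TopologicalSpace N] (G : TorusGluing N) (x y : N) : Prop :=
  x = y ∨ ∃ (i : Fin G.numPairs) (a : G.left i),
    (x = a ∧ y = G.glue i a) ∨ (y = a ∧ x = G.glue i a)

/-- A Waldhausen manifold: a compact `3`-manifold that is obtained from Seifert manifolds (the
connected components of `N`) by gluing them along pairs of boundary tori, i.e. it is the
topological quotient of `N` by the relation of some gluing. No torus has to be glued, and the two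
tori of a pair may belong to the same component of `N`. -/
def IsWaldhausenManifold (M : Type u) [TopologicalSpace M] : Prop :=
  IsTopologicalManifold 3 M ∧ CompactSpace M ∧
    ∃ (N : Type u) (_ : TopologicalSpace N) (G : TorusGluing N) (q : N → M),
      IsSeifertManifold N ∧ Topology.IsQuotientMap q ∧ ∀ x y : N, q x = q y ↔ G.Rel x y

end ThreeManifold

/-!
A finite covering of a Waldhausen manifold is a Waldhausen manifold.

Let `M` be the quotient of the compact Seifert manifold `N` by a gluing of boundary tori, with
quotient map `q : N → M`, and let `π : M' → M` be a finite covering. The pullback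
`N' = {(m, n) | π m = q n}` is a finite covering of `N`, and `M'` is the quotient of `N'` under the
first projection. Two things have to be seen: `N'` is a Seifert manifold, and the identifications
made by the first projection come from a gluing of boundary tori of `N'`.

Both rest on the description of the finite coverings of `D × (S¹)^r` for contractible `D`
(`IsCoveringMap.exists_clopen_homeomorph_torus`). The universal covering `D × ℝ^r` lifts through
such a covering; the lifts have clopen ranges, and each of these ranges is the quotient of
`D × ℝ^r` by a subgroup of finite index in `ℤ^r`. A basis of the subgroup identifies the range with
`D × (S¹)^r` again, so that the covering map becomes monomial in the circle coordinates.

For the Seifert property (`IsSeifertManifold.of_isCoveringMap`), let `p : N → F` be a Seifert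
fibration and `ρ : N' → N` the covering. The new base is the leaf space of `p ∘ ρ`, obtained by
collapsing the components of its fibres. With `r = 1`, the part of `N'` over a small disc of `F` is
a union of clopen copies of `D × S¹` mapping to `N` by `(z, w) ↦ (z, w ^ k)`. Over a trivially
fibred piece, the leaves are the circles `{z} × S¹`. Over a fibred solid torus with invariants
`(α, ν)`, the composition is `(z, w) ↦ z ^ α * w ^ (k * ν)`, which is the `d`-th power of the
projection of the fibred solid torus with invariants `(α / d, k * ν / d)`, where
`d = gcd(α, k * ν)`; as the fibres of that projection are connected, they are the leaves. So the
leaf space is a surface, and the projection onto it is a Seifert fibration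
(`isSeifertFibration_toLeaf`).

For the gluing (`TorusGluing.exists_pullback`), the case `D` a point and `r = 2` shows that the
components of the preimage of a boundary torus are tori
(`IsBoundaryTorus.image_connectedComponent`). They are components of the boundary, since the
boundary is defined locally and `ρ` is a local homeomorphism. The gluing homeomorphism of a pair of
tori lifts to the preimages of its two members and carries components to components.
-/

noncomputable section

open Topology

/-! ### Finite coverings of `D × (S¹)^r` -/

/-- Two quotient maps with the same fibres have homeomorphic targets. -/
def Topology.IsQuotientMap.homeomorphOfFibers {X Y Z : Type*} [TopologicalSpace X]
    [TopologicalSpace Y] [TopologicalSpace Z] {f : X → Y} {g : X → Z} (hf : IsQuotientMap f)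
    (hg : IsQuotientMap g) (h : ∀ a b, f a = f b ↔ g a = g b) : Y ≃ₜ Z where
  toFun y := g (Function.surjInv hf.surjective y)
  invFun z := f (Function.surjInv hg.surjective z)
  left_inv y := by
    refine ((h _ _).2 ?_).trans (Function.surjInv_eq hf.surjective y)
    exact Function.surjInv_eq hg.surjective _
  right_inv z := by
    refine ((h _ _).1 ?_).trans (Function.surjInv_eq hg.surjective z)
    exact Function.surjInv_eq hf.surjective _
  continuous_toFun := by
    rw [hf.continuous_iff]
    convert! hg.continuous using 1
    ext a
    exact (h _ _).1 (Function.surjInv_eq hf.surjective _)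
  continuous_invFun := by
    rw [hg.continuous_iff]
    convert! hf.continuous using 1
    ext a
    exact (h _ _).2 (Function.surjInv_eq hg.surjective _)

theorem Topology.IsQuotientMap.homeomorphOfFibers_apply {X Y Z : Type*} [TopologicalSpace X]
    [TopologicalSpace Y] [TopologicalSpace Z] {f : X → Y} {g : X → Z} (hf : IsQuotientMap f)
    (hg : IsQuotientMap g) (h : ∀ a b, f a = f b ↔ g a = g b) (a : X) :
    hf.homeomorphOfFibers hg h (f a) = g a :=
  (h _ _).1 (Function.surjInv_eq hf.surjective _)

/-- A subgroup of finite index in `ℤ^r` is the image of `ℤ^r` under an integral matrix with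
nonzero determinant. The finite index is expressed by a map to a finite set whose fibres lie in
cosets of the subgroup. -/
theorem exists_matrix_range_eq {r : ℕ} (H : Submodule ℤ (Fin r → ℤ)) {κ : Type*} [Finite κ]
    (c : (Fin r → ℤ) → κ) (hc : ∀ m n, c m = c n → m - n ∈ H) :
    ∃ A : Matrix (Fin r) (Fin r) ℤ, A.det ≠ 0 ∧ ∀ n, n ∈ H ↔ ∃ m, n = A.mulVec m := by
  have key : ∀ v : Fin r → ℤ, ∃ k : ℕ, 0 < k ∧ (k : ℤ) • v ∈ H := by
    intro v
    obtain ⟨i, j, hij, he⟩ := Finite.exists_ne_map_eq_of_infinite (fun k : ℕ => c ((k : ℤ) • v))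
    wlog hlt : i < j generalizing i j
    · exact this j i hij.symm he.symm (lt_of_le_of_ne (not_lt.1 hlt) hij.symm)
    refine ⟨j - i, by omega, ?_⟩
    have := hc _ _ he.symm
    rwa [← sub_smul, ← Nat.cast_sub hlt.le] at this
  choose k hk0 hk using key
  have hrank : Module.finrank ℤ H = r := by
    apply le_antisymm
    · simpa using Submodule.finrank_le H
    · let e : Fin r → H := fun i => ⟨_, hk (Pi.single i 1)⟩
      have hli : LinearIndependent ℤ e := by
        rw [Fintype.linearIndependent_iff]
        intro g hg i
        have := congrFun (congrArg (Subtype.val) hg) i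
        simp only [AddSubmonoidClass.coe_finsetSum, e, Submodule.coe_smul, Finset.sum_apply,
          Pi.smul_apply, Pi.single_apply, smul_eq_mul, mul_ite, mul_one, mul_zero,
          Finset.sum_ite_eq, Finset.mem_univ, if_true, ZeroMemClass.coe_zero, Pi.zero_apply] at this
        have h0 := hk0 (Pi.single i 1)
        rcases mul_eq_zero.1 this with h | h
        · exact h
        · omega
      simpa using hli.fintype_card_le_finrank
  let b := Module.finBasisOfFinrankEq ℤ H hrank
  let A : Matrix (Fin r) (Fin r) ℤ := Matrix.of fun i j => (b j : Fin r → ℤ) i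
  have hA : ∀ m, A.mulVec m = ((∑ j, m j • b j : H) : Fin r → ℤ) := by
    intro m
    ext i
    simp [A, Matrix.mulVec, dotProduct, mul_comm]
  refine ⟨A, ?_, fun n => ⟨fun hn => ⟨b.repr ⟨n, hn⟩, ?_⟩, ?_⟩⟩
  · intro h0
    obtain ⟨v, hv, hAv⟩ := Matrix.exists_mulVec_eq_zero_iff.2 h0
    rw [hA, Submodule.coe_eq_zero] at hAv
    exact hv (funext fun i => Fintype.linearIndependent_iff.1 b.linearIndependent v hAv i)
  · rw [hA, b.sum_repr]
  · rintro ⟨m, rfl⟩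
    rw [hA]
    exact Subtype.property _

theorem Circle.exp_sum {ι : Type*} (s : Finset ι) (t : ι → ℝ) :
    Circle.exp (∑ i ∈ s, t i) = ∏ i ∈ s, Circle.exp (t i) := by
  classical
  induction s using Finset.induction_on with
  | empty => simp
  | insert i s hi ih => rw [Finset.sum_insert hi, Finset.prod_insert hi, Circle.exp_add, ih]

section TorusCover

variable {D : Type*} {r : ℕ}

/-- The universal covering `ℝ^r → (S¹)^r`, multiplied by the identity of a space `D`. -/
def torusExp (D : Type*) (r : ℕ) : D × (Fin r → ℝ) → D × (Fin r → Circle) :=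
  Prod.map id (Pi.map fun _ t => Circle.exp (2 * Real.pi * t))

/-- Translation of the `ℝ^r` factor by an integral vector. -/
def latticeShift (n : Fin r → ℤ) (y : D × (Fin r → ℝ)) : D × (Fin r → ℝ) :=
  (y.1, y.2 + fun i => (n i : ℝ))

theorem torusExp_eq_iff {y y' : D × (Fin r → ℝ)} :
    torusExp D r y = torusExp D r y' ↔ ∃ n, y' = latticeShift n y := by
  obtain ⟨d, t⟩ := y
  obtain ⟨d', t'⟩ := y'
  have h1 : ∀ a b : ℝ, Circle.exp (2 * Real.pi * a) = Circle.exp (2 * Real.pi * b) ↔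
      ∃ n : ℤ, b = a + n := by
    intro a b
    rw [eq_comm, Circle.exp_eq_exp]
    refine exists_congr fun n => ?_
    have : (2 * Real.pi) ≠ 0 := by positivity
    rw [← mul_right_inj' this (b := b)]
    ring_nf
  simp only [torusExp, latticeShift, Prod.map_apply, id, Prod.mk.injEq, funext_iff, Pi.map_apply,
    h1, Pi.add_apply, Classical.skolem, exists_and_left]
  exact and_congr eq_comm Iff.rfl

theorem torusExp_latticeShift (n : Fin r → ℤ) (y : D × (Fin r → ℝ)) :
    torusExp D r (latticeShift n y) = torusExp D r y :=
  (torusExp_eq_iff.2 ⟨n, rfl⟩).symm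

theorem latticeShift_add (m n : Fin r → ℤ) (y : D × (Fin r → ℝ)) :
    latticeShift (m + n) y = latticeShift m (latticeShift n y) := by
  simp only [latticeShift, Prod.mk.injEq, true_and]
  ext i
  simp
  ring

theorem latticeShift_zero (y : D × (Fin r → ℝ)) : latticeShift 0 y = y := by
  ext <;> simp [latticeShift]

variable {X : Type*} [TopologicalSpace D] [TopologicalSpace X]

theorem isOpenQuotientMap_torusExp : IsOpenQuotientMap (torusExp D r) := by
  refine IsOpenQuotientMap.prodMap .id (IsOpenQuotientMap.piMap fun _ => ?_)
  exact Circle.isAddQuotientCoveringMap_exp.isOpenQuotientMap.comp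
    (Homeomorph.mulLeft₀ (2 * Real.pi) (by positivity)).isOpenQuotientMap

theorem continuous_latticeShift (n : Fin r → ℤ) : Continuous (latticeShift (D := D) n) := by
  unfold latticeShift
  fun_prop

/-- A continuous lift of an open map through a local homeomorphism is open. -/
theorem IsLocalHomeomorph.isOpenMap_of_comp {Y Z : Type*} [TopologicalSpace Y] [TopologicalSpace Z]
    {f : X → Z} (hf : IsLocalHomeomorph f) {φ : Y → X} (hφ : Continuous φ)
    (h : IsOpenMap (f ∘ φ)) : IsOpenMap φ := by
  rw [isOpenMap_iff_nhds_le] at h ⊢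
  intro y
  obtain ⟨e, he, rfl⟩ := hf (φ y)
  intro s hs
  rw [Filter.mem_map] at hs
  have h1 := h y (Filter.image_mem_map (Filter.inter_mem hs
    (hφ.continuousAt.preimage_mem_nhds (e.open_source.mem_nhds he))))
  have h2 := Filter.inter_mem (Filter.mem_map.1 (e.continuousAt he h1)) (e.open_source.mem_nhds he)
  refine Filter.mem_of_superset h2 ?_
  rintro x ⟨⟨z, ⟨hz1, hz2⟩, hz3⟩, hx⟩
  rw [← e.injOn hz2 hx hz3]
  exact hz1

/-- Every point of a finite covering space of `D × (S¹)^r`, with `D` contractible, lies in a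
clopen subset homeomorphic to `D × (S¹)^r`, on which the covering map is given by monomials in the
circle coordinates. -/
theorem IsCoveringMap.exists_clopen_homeomorph_torus [ContractibleSpace D]
    [LocallyPathConnectedSpace D] {f : X → D × (Fin r → Circle)} (hf : IsCoveringMap f)
    (hfin : ∀ z, (f ⁻¹' {z}).Finite) (x : X) :
    ∃ (A : Matrix (Fin r) (Fin r) ℤ) (W : Set X) (ψ : D × (Fin r → Circle) ≃ₜ W),
      IsClopen W ∧ x ∈ W ∧ ∀ d w, f (ψ (d, w)) = (d, fun i => ∏ j, w j ^ A i j) := by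
  have hE := isOpenQuotientMap_torusExp (D := D) (r := r)
  have lift : ∀ x : X, ∃ φ : C(D × (Fin r → ℝ), X), f ∘ φ = torusExp D r ∧ x ∈ Set.range φ := by
    intro x
    obtain ⟨y, hy⟩ := hE.surjective (f x)
    obtain ⟨φ, ⟨h1, h2⟩, -⟩ := hf.existsUnique_continuousMap_lifts ⟨_, hE.continuous⟩ y x hy.symm
    exact ⟨φ, h2, y, h1⟩
  have openRange : ∀ φ : C(D × (Fin r → ℝ), X), f ∘ φ = torusExp D r → IsOpenMap φ := fun φ h =>
    hf.isLocalHomeomorph.isOpenMap_of_comp φ.continuous (h ▸ hE.isOpenMap)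
  -- Two lifts whose ranges meet differ by a deck transformation of the universal covering.
  have shift : ∀ φ φ' : C(D × (Fin r → ℝ), X), f ∘ φ = torusExp D r → f ∘ φ' = torusExp D r →
      ∀ y y', φ y = φ' y' → ∃ n, y' = latticeShift n y ∧ φ = φ' ∘ latticeShift n := by
    intro φ φ' h h' y y' he
    obtain ⟨n, rfl⟩ := torusExp_eq_iff.1
      (show torusExp D r y = torusExp D r y' by
        rw [← congrFun h y, ← congrFun h' y']; exact congrArg f he)
    refine ⟨n, rfl, hf.eq_of_comp_eq φ.continuous (φ'.continuous.comp (continuous_latticeShift n))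
      ?_ y he⟩
    rw [h, ← Function.comp_assoc, h']
    exact funext fun z => (torusExp_latticeShift n z).symm
  obtain ⟨φ, hφ, y₀, hy₀⟩ := lift x
  have hclopen : IsClopen (Set.range φ) := by
    refine ⟨⟨?_⟩, (openRange φ hφ).isOpen_range⟩
    rw [isOpen_iff_mem_nhds]
    intro x' hx'
    obtain ⟨φ', hφ', hx⟩ := lift x'
    refine Filter.mem_of_superset ((openRange φ' hφ').isOpen_range.mem_nhds hx) ?_
    rintro _ ⟨y', rfl⟩ ⟨y, hy⟩
    obtain ⟨n, -, hn⟩ := shift φ' φ hφ' hφ y' y hy.symm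
    obtain ⟨z, rfl⟩ := hx
    exact hx' ⟨latticeShift n z, (congrFun hn z).symm⟩
  let H : Submodule ℤ (Fin r → ℤ) := AddSubgroup.toIntSubmodule
    { carrier := {n | ∀ y, φ (latticeShift n y) = φ y}
      add_mem' := fun {m n} hm hn y => by rw [latticeShift_add, hm, hn]
      zero_mem' := fun y => by rw [latticeShift_zero]
      neg_mem' := fun {n} hn y => by
        rw [← hn, ← latticeShift_add, add_neg_cancel, latticeShift_zero] }
  have hH : ∀ n, n ∈ H ↔ ∀ y, φ (latticeShift n y) = φ y := fun n => Iff.rfl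
  have hker : ∀ y y', φ y = φ y' ↔ ∃ n ∈ H, y' = latticeShift n y := by
    intro y y'
    constructor
    · intro h
      obtain ⟨n, h1, h2⟩ := shift φ φ hφ hφ y y' h
      exact ⟨n, fun z => (congrFun h2 z).symm, h1⟩
    · rintro ⟨n, hn, rfl⟩
      exact (hn y).symm
  have : Finite (f ⁻¹' {f x}) := hfin _
  obtain ⟨A, hdet, hA⟩ := exists_matrix_range_eq H
    (fun n => (⟨φ (latticeShift n y₀), by
      show f (φ _) = f x
      rw [← hy₀, ← Function.comp_apply (f := f), ← Function.comp_apply (f := f) (g := φ), hφ,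
        torusExp_latticeShift]⟩ : f ⁻¹' {f x})) (by
      intro m n hmn
      obtain ⟨k, hk, hk'⟩ := (hker _ _).1 (congrArg Subtype.val hmn)
      have h3 : m - n = -k := by
        ext i
        have := congrFun (congrArg Prod.snd hk') i
        simp only [latticeShift, Pi.add_apply] at this
        have h4 : (n i : ℝ) = m i + k i := by linarith
        have h5 : n i = m i + k i := by exact_mod_cast h4
        simp [h5]
      rw [h3]
      exact H.neg_mem hk)
  -- The real linear automorphism of `ℝ^r` which carries `ℤ^r` to the lattice of periods.
  let B : Matrix (Fin r) (Fin r) ℝ := A.map (Int.cast)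
  have hB : IsUnit B.det := by
    have : B.det = ((A.det : ℤ) : ℝ) := (Int.cast_det A).symm
    rw [this]
    exact (Int.cast_ne_zero.2 hdet).isUnit
  let L : (Fin r → ℝ) ≃L[ℝ] (Fin r → ℝ) := (Matrix.toLin'OfInv (Matrix.nonsing_inv_mul B hB)
    (Matrix.mul_nonsing_inv B hB)).toContinuousLinearEquiv
  have hL : ∀ v, L v = B.mulVec v := fun v => Matrix.toLin'_apply B v
  let φ₁ : D × (Fin r → ℝ) → Set.range φ := fun y => ⟨φ (y.1, L y.2), _, rfl⟩
  have hφ₁c : Continuous φ₁ := by fun_prop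
  have hφ₁ : IsQuotientMap φ₁ := by
    refine IsOpenMap.isQuotientMap ?_ hφ₁c ?_
    · have h1 : IsOpenMap (Subtype.val ∘ φ₁) := (openRange φ hφ).comp
        ((Homeomorph.refl D).prodCongr L.toHomeomorph).isOpenMap
      intro s hs
      convert! (h1 s hs).preimage continuous_subtype_val using 1
      ext a
      simp [Subtype.ext_iff]
    · rintro ⟨_, ⟨d, t⟩, rfl⟩
      exact ⟨(d, L.symm t), by simp [φ₁]⟩
  have hfib : ∀ a b, torusExp D r a = torusExp D r b ↔ φ₁ a = φ₁ b := by
    intro a b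
    rw [torusExp_eq_iff, Subtype.ext_iff, hker]
    have hcast : ∀ m : Fin r → ℤ, (fun i => ((A.mulVec m i : ℤ) : ℝ)) = L fun i => (m i : ℝ) := by
      intro m
      ext i
      simp [hL, B, Matrix.mulVec, dotProduct]
    constructor
    · rintro ⟨n, rfl⟩
      exact ⟨A.mulVec n, (hA _).2 ⟨n, rfl⟩, by simp [latticeShift, hcast]⟩
    · rintro ⟨n, hn, hn'⟩
      obtain ⟨m, rfl⟩ := (hA _).1 hn
      refine ⟨m, ?_⟩
      simp only [latticeShift, hcast, ← map_add, Prod.mk.injEq, L.injective.eq_iff] at hn' ⊢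
      exact Prod.ext hn'.1 hn'.2
  refine ⟨A, Set.range φ, hE.isQuotientMap.homeomorphOfFibers hφ₁ hfib, hclopen, ⟨y₀, hy₀⟩, ?_⟩
  intro d w
  obtain ⟨⟨d', t⟩, ht⟩ := hE.surjective (d, w)
  obtain ⟨rfl, rfl⟩ : d' = d ∧ (fun i => Circle.exp (2 * Real.pi * t i)) = w := Prod.ext_iff.1 ht
  rw [← ht, Topology.IsQuotientMap.homeomorphOfFibers_apply]
  show (f ∘ φ) _ = _
  rw [hφ]
  refine Prod.ext rfl (funext fun i => ?_)
  simp only [torusExp, Prod.map_apply, Pi.map_apply, hL, Matrix.mulVec, dotProduct, B,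
    Matrix.map_apply, Finset.mul_sum]
  rw [Circle.exp_sum]
  refine Finset.prod_congr rfl fun j _ => ?_
  rw [← Circle.exp_zsmul, zsmul_eq_mul]
  congr 1
  ring

end TorusCover

namespace ThreeManifold

/-! ### Manifolds and local homeomorphisms -/

/-- A compact Hausdorff space with half-space charts is automatically second countable. -/
theorem IsTopologicalManifold.of_compactSpace {n : ℕ} [NeZero n] {X : Type u} [TopologicalSpace X]
    [T2Space X] [CompactSpace X]
    (h : ∀ x : X, ∃ e : OpenPartialHomeomorph X (EuclideanHalfSpace n), x ∈ e.source) :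
    IsTopologicalManifold n X where
  t2 := inferInstance
  exists_chart := h
  secondCountable := by
    choose e he using h
    obtain ⟨t, ht⟩ := isCompact_univ.elim_nhds_subcover (fun x => (e x).source)
      fun x _ => (e x).open_source.mem_nhds (he x)
    have : SecondCountableTopology (EuclideanHalfSpace n) :=
      inferInstanceAs (SecondCountableTopology { x : EuclideanSpace ℝ (Fin n) // 0 ≤ x 0 })
    have : ∀ x : t, SecondCountableTopology (e x).source := fun x =>
      (e x).secondCountableTopology_source
    refine TopologicalSpace.secondCountableTopology_of_countable_cover
      (U := fun x : t => (e x).source) (fun x => (e x).open_source) ?_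
    rw [Set.eq_univ_iff_forall]
    intro x
    obtain ⟨y, hy, hx⟩ := Set.mem_iUnion₂.1 (ht.2 (Set.mem_univ x))
    exact Set.mem_iUnion.2 ⟨⟨y, hy⟩, hx⟩

theorem _root_.IsLocalHomeomorph.exists_chart {X Y H : Type*} [TopologicalSpace X]
    [TopologicalSpace Y] [TopologicalSpace H] {f : X → Y} (hf : IsLocalHomeomorph f) {x : X}
    (h : ∃ e : OpenPartialHomeomorph Y H, f x ∈ e.source) :
    ∃ e : OpenPartialHomeomorph X H, x ∈ e.source := by
  obtain ⟨φ, hx, rfl⟩ := hf x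
  obtain ⟨e, he⟩ := h
  exact ⟨φ.trans e, by simpa [hx] using he⟩

theorem _root_.IsLocalHomeomorph.preimage_manifoldBoundary {n : ℕ} {X Y : Type u}
    [TopologicalSpace X] [TopologicalSpace Y] {f : X → Y} (hf : IsLocalHomeomorph f) :
    f ⁻¹' manifoldBoundary n Y = manifoldBoundary n X := by
  ext x
  refine not_congr ⟨fun h => hf.exists_chart h, ?_⟩
  rintro ⟨e, he⟩
  obtain ⟨φ, hx, rfl⟩ := hf x
  exact ⟨φ.symm.trans e, by simpa [hx] using he⟩

/-! ### The leaf space of a map -/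

section Leaf

variable {X F D : Type*} [TopologicalSpace X] [TopologicalSpace D]

/-- The leaf of `P` through `x`: the connected component of `x` in its fibre. -/
def leaf (P : X → F) (x : X) : Set X := connectedComponentIn (P ⁻¹' {P x}) x

/-- The leaf space of `P`: the quotient of the total space in which every connected component of a
fibre is collapsed to a point. -/
def LeafSpace (P : X → F) := Quotient (Setoid.ker (leaf P))

instance (P : X → F) : TopologicalSpace (LeafSpace P) :=
  inferInstanceAs (TopologicalSpace (Quotient _))

namespace LeafSpace

/-- The projection of the total space of `P` onto the leaf space. -/
def toLeaf (P : X → F) (x : X) : LeafSpace P := Quotient.mk _ x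

theorem isQuotientMap_toLeaf (P : X → F) : IsQuotientMap (toLeaf P) := isQuotientMap_quotient_mk'

theorem toLeaf_eq_iff {P : X → F} {x y : X} : toLeaf P x = toLeaf P y ↔ leaf P x = leaf P y :=
  Quotient.eq

theorem mem_leaf (P : X → F) (x : X) : x ∈ leaf P x := mem_connectedComponentIn rfl

theorem eq_of_leaf_eq {P : X → F} {x y : X} (h : leaf P x = leaf P y) : P x = P y :=
  by
  have h1 : x ∈ leaf P y := h ▸ mem_leaf P x
  exact connectedComponentIn_subset (P ⁻¹' {P y}) y h1

/-- The map from the leaf space to the base. -/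
def toBase (P : X → F) : LeafSpace P → F := Quotient.lift P fun _ _ h => eq_of_leaf_eq h

theorem toBase_toLeaf (P : X → F) (x : X) : toBase P (toLeaf P x) = P x := rfl

theorem continuous_toBase [TopologicalSpace F] {P : X → F} (hP : Continuous P) :
    Continuous (toBase P) :=
  (isQuotientMap_toLeaf P).continuous_iff.2 hP

end LeafSpace

/-- The map `σ : W → D` is a chart for the leaf space of `P : X → F`: `W` is a connected open set,
clopen in the part of `X` over the open set `U`, the fibres of `σ` are connected, and `P` is the
composition of `σ` with a map `r` with finite fibres. It follows that the fibres of `σ` are leaves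
of `P`. -/
structure IsLeafChart (P : X → F) (U : Set F) (W : Set X) (σ : W → D) (r : D → F) : Prop where
  isOpen : IsOpen W
  isPreconnected : IsPreconnected W
  subset : W ⊆ P ⁻¹' U
  isOpen_diff : IsOpen (P ⁻¹' U \ W)
  isQuotientMap : IsQuotientMap σ
  isPreconnected_fiber : ∀ d, IsPreconnected (Subtype.val '' (σ ⁻¹' {d}))
  factor : ∀ x : W, P x = r (σ x)
  finite : ∀ b, (r ⁻¹' {b}).Finite

namespace IsLeafChart

open LeafSpace

variable {P : X → F} {U : Set F} {W : Set X} {σ : W → D} {r : D → F}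

/-- A preconnected set over `U` that meets `W` is contained in `W`. -/
theorem subset_of_mem (h : IsLeafChart P U W σ r) {C : Set X} (hC : IsPreconnected C)
    (hCU : C ⊆ P ⁻¹' U) {x : X} (hxC : x ∈ C) (hxW : x ∈ W) : C ⊆ W :=
  hC.subset_left_of_subset_union h.isOpen h.isOpen_diff Set.disjoint_sdiff_right
    (by rwa [Set.union_sdiff_cancel h.subset]) ⟨x, hxC, hxW⟩

/-- A leaf meeting `W` stays in `W`, and its image under `σ` is connected and contained in a finite
set, hence a point. -/
theorem leaf_eq [T1Space D] (h : IsLeafChart P U W σ r) (x : W) :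
    leaf P x = Subtype.val '' (σ ⁻¹' {σ x}) := by
  apply Set.Subset.antisymm
  · have hC : IsPreconnected (leaf P x) := isPreconnected_connectedComponentIn
    have hsub : leaf P x ⊆ P ⁻¹' {P x} := connectedComponentIn_subset _ _
    have hW : leaf P x ⊆ W := h.subset_of_mem hC
      (fun y hy => by have := hsub hy; simp only [Set.mem_preimage, Set.mem_singleton_iff] at this ⊢
                      rw [this]; exact h.subset x.2) (mem_leaf P x) x.2
    have hC' : IsPreconnected (Subtype.val ⁻¹' leaf P x : Set W) :=
      hC.preimage_of_isOpenMap Subtype.val_injective h.isOpen.isOpenMap_subtype_val (by simpa)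
    have him := hC'.image σ h.isQuotientMap.continuous.continuousOn
    have hfin : (σ '' (Subtype.val ⁻¹' leaf P x)).Finite := by
      refine (h.finite (P x)).subset ?_
      rintro _ ⟨y, hy, rfl⟩
      rw [Set.mem_preimage, ← h.factor]
      exact hsub hy
    have hss : (σ '' (Subtype.val ⁻¹' leaf P x)).Subsingleton := by
      by_contra hns
      exact him.infinite_of_nontrivial (Set.not_subsingleton_iff.1 hns) hfin
    intro y hy
    exact ⟨⟨y, hW hy⟩, hss ⟨_, hy, rfl⟩ ⟨x, mem_leaf P x, rfl⟩, rfl⟩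
  · refine (h.isPreconnected_fiber _).subset_connectedComponentIn ⟨x, rfl, rfl⟩ ?_
    rintro _ ⟨y, hy, rfl⟩
    rw [Set.mem_preimage, Set.mem_singleton_iff, h.factor, h.factor,
      Set.mem_singleton_iff.1 hy]

theorem toLeaf_eq_iff [T1Space D] (h : IsLeafChart P U W σ r) (x y : W) :
    toLeaf P x = toLeaf P y ↔ σ x = σ y := by
  rw [LeafSpace.toLeaf_eq_iff, h.leaf_eq, h.leaf_eq]
  constructor
  · intro he
    have hx : (x : X) ∈ Subtype.val '' (σ ⁻¹' {σ x}) := ⟨x, rfl, rfl⟩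
    rw [he] at hx
    obtain ⟨z, hz, hzx⟩ := hx
    rwa [Subtype.ext hzx] at hz
  · intro he
    rw [he]

theorem preimage_image_toLeaf [T1Space D] (h : IsLeafChart P U W σ r) :
    toLeaf P ⁻¹' (toLeaf P '' W) = W := by
  apply Set.Subset.antisymm _ (Set.subset_preimage_image _ _)
  rintro y ⟨x, hx, hxy⟩
  have := mem_leaf P y
  rw [← LeafSpace.toLeaf_eq_iff.1 hxy, h.leaf_eq ⟨x, hx⟩] at this
  obtain ⟨z, -, rfl⟩ := this
  exact z.2

theorem isOpen_image_toLeaf [T1Space D] (h : IsLeafChart P U W σ r) : IsOpen (toLeaf P '' W) := by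
  rw [← (isQuotientMap_toLeaf P).isOpen_preimage, h.preimage_image_toLeaf]
  exact h.isOpen

theorem isQuotientMap_restrict [T1Space D] (h : IsLeafChart P U W σ r) :
    IsQuotientMap (fun x : W => (⟨toLeaf P x, x, x.2, rfl⟩ : toLeaf P '' W)) := by
  refine (isQuotientMap_iff _).2 ⟨isCoinducing_iff.2 fun s => ⟨fun hs => ?_, fun hs => ?_⟩, ?_⟩
  rotate_left
  · exact hs.preimage
      (((isQuotientMap_toLeaf P).continuous.comp continuous_subtype_val).subtype_mk _)
  · rintro ⟨_, x, hx, rfl⟩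
    exact ⟨⟨x, hx⟩, rfl⟩
  · have h1 : IsOpen (Subtype.val '' s) := by
      rw [← (isQuotientMap_toLeaf P).isOpen_preimage]
      convert! h.isOpen.isOpenMap_subtype_val _ hs using 1
      ext x
      constructor
      · rintro ⟨⟨y, hy⟩, hys, hyx⟩
        have hx : x ∈ W := by
          rw [← h.preimage_image_toLeaf, Set.mem_preimage, ← hyx]
          exact hy
        obtain rfl : y = toLeaf P x := hyx
        exact ⟨⟨x, hx⟩, hys, rfl⟩
      · rintro ⟨y, hy, rfl⟩
        exact ⟨_, hy, rfl⟩
    convert! h1.preimage continuous_subtype_val using 1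
    rw [Set.preimage_image_eq _ Subtype.val_injective]

/-- The homeomorphism induced by a leaf chart between an open subset of the leaf space and the
target of the chart. -/
def homeomorph [T1Space D] (h : IsLeafChart P U W σ r) : toLeaf P '' W ≃ₜ D :=
  h.isQuotientMap_restrict.homeomorphOfFibers h.isQuotientMap fun a b => by
    rw [Subtype.ext_iff]
    exact h.toLeaf_eq_iff a b

theorem homeomorph_toLeaf [T1Space D] (h : IsLeafChart P U W σ r) (x : W) :
    h.homeomorph ⟨toLeaf P x, x, x.2, rfl⟩ = σ x :=
  h.isQuotientMap_restrict.homeomorphOfFibers_apply h.isQuotientMap _ x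

theorem factor_toBase [T1Space D] (h : IsLeafChart P U W σ r) (b : toLeaf P '' W) :
    toBase P b = r (h.homeomorph b) := by
  obtain ⟨_, x, hx, rfl⟩ := b
  rw [h.homeomorph_toLeaf ⟨x, hx⟩, toBase_toLeaf]
  exact h.factor ⟨x, hx⟩

theorem finite_inter_toBase [T1Space D] (h : IsLeafChart P U W σ r) (b : F) :
    (toLeaf P '' W ∩ toBase P ⁻¹' {b}).Finite := by
  have h1 : (Subtype.val ∘ h.homeomorph.symm '' (r ⁻¹' {b})).Finite := (h.finite b).image _
  refine h1.subset ?_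
  rintro c ⟨hc, hcb⟩
  refine ⟨h.homeomorph ⟨c, hc⟩, ?_, by simp⟩
  rw [Set.mem_preimage, ← h.factor_toBase]
  exact hcb

end IsLeafChart

end Leaf

/-! ### Seifert fibrations onto leaf spaces -/

/-- A local trivialization from a homeomorphism over an open set of the base. The points `b` and `z`
serve as values outside the source and the target. -/
def trivializationOfHomeomorph {N F Z : Type*} [TopologicalSpace N] [TopologicalSpace F]
    [TopologicalSpace Z] {p : N → F} (hp : Continuous p) {V : Set F} (hV : IsOpen V)
    (H : p ⁻¹' V ≃ₜ V × Z) (hH : ∀ x, ((H x).1 : F) = p x) (b : V) (z : Z) :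
    Bundle.Trivialization Z p := by
  classical exact
  { toFun e := if he : p e ∈ V then ⟨(H ⟨e, he⟩).1, (H ⟨e, he⟩).2⟩ else ⟨b, z⟩
    invFun y := H.symm (if hy : y.1 ∈ V then ⟨y.1, hy⟩ else b, y.2)
    source := p ⁻¹' V
    target := V ×ˢ Set.univ
    map_source' e (he : p e ∈ V) := by simp [he]
    map_target' _ _ := Subtype.coe_prop _
    left_inv' e (he : p e ∈ V) := by simp [he]
    right_inv' y := by rintro ⟨hy, -⟩; simpa [hy] using fun h => (h (H.symm _).2).elim
    open_source := hV.preimage hp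
    open_target := hV.prod isOpen_univ
    continuousOn_toFun := continuousOn_iff_continuous_domRestrict.mpr <|
      ((continuous_subtype_val.prodMap continuous_id).comp H.continuous).congr
      fun ⟨e, (he : p e ∈ V)⟩ => by simp [Prod.map, he]
    continuousOn_invFun := continuousOn_iff_continuous_domRestrict.mpr <|
      ((continuous_subtype_val.comp H.symm.continuous).comp (by fun_prop :
        Continuous fun ui => ⟨⟨_, ui.2.1⟩, ui.1.2⟩)).congr fun ⟨⟨x, i⟩, ⟨hx, _⟩⟩ => by simp [hx]
    baseSet := V
    open_baseSet := hV
    source_eq := rfl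
    target_eq := rfl
    proj_toFun e (he : p e ∈ V) := by simp [he, hH] }

/-- The local structure of a map `P : X → F` with circle leaves: over some neighbourhood `U` of
`b`, the total space is a union of clopen pieces `W` with leaf charts `W → U`. These charts are
trivial circle bundles if `b` is not in the finite set `E`; if `b ∈ E`, they are fibred solid tori
with cores in the fibre over `b`. -/
def HasLeafCharts {X F : Type u} [TopologicalSpace X] [TopologicalSpace F] (P : X → F)
    (E : Set F) (b : F) : Prop :=
  ∃ U : Set F, IsOpen U ∧ b ∈ U ∧ ∀ x ∈ P ⁻¹' U, ∃ (W : Set X) (σ : W → U) (r : U → F)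
    (hx : x ∈ W), IsLeafChart P U W σ r ∧
      (b ∉ E → ∃ H : W ≃ₜ U × Circle, ∀ y, σ y = (H y).1) ∧
      (b ∈ E → P x = b → ∃ (α : ℕ) (ν : ℤ), 0 < α ∧ IsCoprime (α : ℤ) ν ∧
        ∃ (g : U ≃ₜ ℂ) (H : W ≃ₜ ℂ × Circle), g (σ ⟨x, hx⟩) = 0 ∧
          ∀ y, g (σ y) = fibredSolidTorusProj α ν (H y))

section

open LeafSpace

variable {X F : Type u} [TopologicalSpace X] [TopologicalSpace F] {P : X → F} {E : Set F}

theorem LeafSpace.t2Space [T2Space F] (hP : Continuous P) (h : ∀ b, HasLeafCharts P E b) :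
    T2Space (LeafSpace P) := by
  refine ⟨fun b c hbc => ?_⟩
  -- Leaves in one fibre lie in the same piece, whose image is Hausdorff, or in disjoint pieces.
  by_cases hF : toBase P b = toBase P c
  · obtain ⟨x, rfl⟩ := (isQuotientMap_toLeaf P).surjective b
    obtain ⟨y, rfl⟩ := (isQuotientMap_toLeaf P).surjective c
    obtain ⟨U, -, hxU, hU⟩ := h (P x)
    have hyU : P y ∈ U := by
      rw [toBase_toLeaf, toBase_toLeaf] at hF
      rwa [← hF]
    obtain ⟨W, σ, r, hxW, hW, -⟩ := hU x hxU
    obtain ⟨W', σ', r', hyW', hW', -⟩ := hU y hyU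
    by_cases hyW : y ∈ W
    · have : T2Space (toLeaf P '' W) := hW.homeomorph.symm.t2Space
      obtain ⟨s, t, hs, ht, hxs, hyt, hst⟩ := t2_separation
        (fun he => hbc (congrArg Subtype.val he) :
          (⟨toLeaf P x, x, hxW, rfl⟩ : toLeaf P '' W) ≠ ⟨toLeaf P y, y, hyW, rfl⟩)
      have ho := hW.isOpen_image_toLeaf.isOpenMap_subtype_val
      exact ⟨_, _, ho s hs, ho t ht, ⟨_, hxs, rfl⟩, ⟨_, hyt, rfl⟩,
        Set.disjoint_image_of_injective Subtype.val_injective hst⟩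
    · refine ⟨_, _, hW.isOpen_image_toLeaf, hW'.isOpen_image_toLeaf, ⟨x, hxW, rfl⟩,
        ⟨y, hyW', rfl⟩, ?_⟩
      rw [Set.disjoint_left]
      rintro _ ⟨z, hz, rfl⟩ ⟨z', hz', he⟩
      have hz2 : z ∈ W' := by
        rw [← hW'.preimage_image_toLeaf]
        exact ⟨z', hz', he⟩
      exact hyW (hW.subset_of_mem hW'.isPreconnected hW'.subset hz2 hz hyW')
  · obtain ⟨s, t, hs, ht, hbs, hct, hst⟩ := t2_separation hF
    exact ⟨_, _, hs.preimage (continuous_toBase hP), ht.preimage (continuous_toBase hP), hbs, hct,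
      hst.preimage _⟩

/-- The fibres of the leaf space over the base are compact, and locally finite since every leaf chart
meets such a fibre in finitely many points. -/
theorem LeafSpace.finite_toBase_preimage [T2Space F] [CompactSpace X] (hP : Continuous P)
    (h : ∀ b, HasLeafCharts P E b) (b : F) : (toBase P ⁻¹' {b}).Finite := by
  have : CompactSpace (LeafSpace P) := inferInstanceAs (CompactSpace (Quotient _))
  have hK : IsCompact (toBase P ⁻¹' {b}) :=
    (isClosed_singleton.preimage (continuous_toBase hP)).isCompact
  rw [← Set.inter_self (toBase P ⁻¹' {b})]
  refine hK.induction_on (p := fun s => (s ∩ toBase P ⁻¹' {b}).Finite) (by simp)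
    (fun s t hst ht => ht.subset (Set.inter_subset_inter_left _ hst))
    (fun s t hs ht => by rw [Set.union_inter_distrib_right]; exact hs.union ht) ?_
  intro c hc
  obtain ⟨x, rfl⟩ := (isQuotientMap_toLeaf P).surjective c
  obtain ⟨U, -, hxU, hU⟩ := h (P x)
  obtain ⟨W, σ, r, hxW, hW, -⟩ := hU x hxU
  exact ⟨_, mem_nhdsWithin_of_mem_nhds (hW.isOpen_image_toLeaf.mem_nhds ⟨x, hxW, rfl⟩),
    hW.finite_inter_toBase b⟩

theorem LeafSpace.isTopologicalManifold [CompactSpace X] {n : ℕ} [NeZero n]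
    (hF : IsTopologicalManifold n F) (hP : Continuous P) (h : ∀ b, HasLeafCharts P E b) :
    IsTopologicalManifold n (LeafSpace P) := by
  have := hF.t2
  have : CompactSpace (LeafSpace P) := inferInstanceAs (CompactSpace (Quotient _))
  have := LeafSpace.t2Space hP h
  refine .of_compactSpace fun c => ?_
  obtain ⟨x, rfl⟩ := (isQuotientMap_toLeaf P).surjective c
  obtain ⟨U, hUo, hxU, hU⟩ := h (P x)
  obtain ⟨W, σ, r, hxW, hW, -⟩ := hU x hxU
  let V : TopologicalSpace.Opens (LeafSpace P) := ⟨_, hW.isOpen_image_toLeaf⟩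
  have hV : Nonempty V := ⟨⟨toLeaf P x, x, hxW, rfl⟩⟩
  obtain ⟨e, he⟩ := (hUo.isOpenEmbedding_subtypeVal.isLocalHomeomorph.comp
    hW.homeomorph.isLocalHomeomorph).exists_chart (x := ⟨toLeaf P x, x, hxW, rfl⟩)
      (hF.exists_chart _)
  exact ⟨(V.openPartialHomeomorphSubtypeCoe hV).symm.trans e, by
    have h1 : toLeaf P x ∈ (V.openPartialHomeomorphSubtypeCoe hV).target := by
      simp only [TopologicalSpace.Opens.openPartialHomeomorphSubtypeCoe_target]
      exact ⟨x, hxW, rfl⟩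
    have h2 : (V.openPartialHomeomorphSubtypeCoe hV).symm (toLeaf P x)
        = ⟨toLeaf P x, x, hxW, rfl⟩ :=
      (V.openPartialHomeomorphSubtypeCoe hV).left_inv (x := ⟨toLeaf P x, x, hxW, rfl⟩) trivial
    rw [OpenPartialHomeomorph.trans_source]
    exact ⟨h1, by rw [Set.mem_preimage, h2]; exact he⟩⟩

/-- If a map of a compact `3`-manifold to a compact surface has leaf charts everywhere, the
projection onto its leaf space is a Seifert fibration. -/
theorem isSeifertFibration_toLeaf [CompactSpace F] (hX : IsTopologicalManifold 3 X)
    (hXc : CompactSpace X)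
    (hF : IsTopologicalManifold 2 F) (hP : Continuous P) (hE : E.Finite)
    (h : ∀ b, HasLeafCharts P E b) : IsSeifertFibration (toLeaf P) := by
  have := hF.t2
  have hc := (isQuotientMap_toLeaf P).continuous
  refine ⟨hX, hXc, LeafSpace.isTopologicalManifold hF hP h,
    inferInstanceAs (CompactSpace (Quotient _)), hc, toBase P ⁻¹' E,
    hE.preimage' fun b _ => LeafSpace.finite_toBase_preimage hP h b, ?_, ?_⟩
  · -- The circle coordinate of the piece `W` trivializes the projection over the image of `W`.
    intro c hcE
    obtain ⟨x, rfl⟩ := (isQuotientMap_toLeaf P).surjective c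
    obtain ⟨U, hUo, hxU, hU⟩ := h (P x)
    obtain ⟨W, σ, r, hxW, hW, hreg, -⟩ := hU x hxU
    obtain ⟨H, hH⟩ := hreg hcE
    refine ⟨trivializationOfHomeomorph hc hW.isOpen_image_toLeaf
      ((Homeomorph.setCongr hW.preimage_image_toLeaf).trans
        (H.trans (hW.homeomorph.symm.prodCongr (.refl _)))) ?_
      ⟨toLeaf P x, x, hxW, rfl⟩ 1, ⟨x, hxW, rfl⟩⟩
    rintro ⟨y, hy⟩
    have hyW : y ∈ W := by rwa [hW.preimage_image_toLeaf] at hy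
    have h1 : hW.homeomorph.symm (H ⟨y, hyW⟩).1 = ⟨toLeaf P y, y, hyW, rfl⟩ := by
      rw [Homeomorph.symm_apply_eq, hW.homeomorph_toLeaf ⟨y, hyW⟩, hH]
    exact congrArg Subtype.val h1
  · intro c hcE
    obtain ⟨x, rfl⟩ := (isQuotientMap_toLeaf P).surjective c
    obtain ⟨U, hUo, hxU, hU⟩ := h (P x)
    obtain ⟨W, σ, r, hxW, hW, -, hexc⟩ := hU x hxU
    obtain ⟨α, ν, hα, hαν, g, H, h0, hH⟩ := hexc hcE rfl
    refine ⟨α, ν, hα, hαν, toLeaf P '' W, ⟨x, hxW, rfl⟩, hW.homeomorph.trans g,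
      (Homeomorph.setCongr hW.preimage_image_toLeaf).trans H, hW.isOpen_image_toLeaf, ?_, ?_⟩
    · rw [Homeomorph.trans_apply, hW.homeomorph_toLeaf ⟨x, hxW⟩, h0]
    · rintro ⟨y, hy⟩
      have hyW : y ∈ W := by rwa [hW.preimage_image_toLeaf] at hy
      rw [Homeomorph.trans_apply]
      refine (congrArg g (hW.homeomorph_toLeaf ⟨y, hyW⟩)).trans (hH _)

end

/-! ### Finite coverings of the local models -/

theorem _root_.Circle.continuous_coe_zpow (n : ℤ) :
    Continuous fun w : Circle => ((w ^ n : Circle) : ℂ) :=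
  continuous_subtype_val.comp (continuous_zpow n)

theorem fibredSolidTorusProj_isQuotientMap {α : ℕ} (hα : 0 < α) (ν : ℤ) :
    IsQuotientMap (fibredSolidTorusProj α ν) := by
  have : NeZero α := ⟨hα.ne'⟩
  have hc : ∀ n : ℤ, Continuous fun x : ℂ × Circle => ((x.2 ^ n : Circle) : ℂ) := fun n =>
    (Circle.continuous_coe_zpow n).comp continuous_snd
  refine IsOpenMap.isQuotientMap ?_ ((continuous_fst.pow α).mul (hc ν)) ?_
  · -- The map is the composition of a power map, a homeomorphism of `ℂ × S¹` and a projection.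
    have hinv : ∀ w : Circle, ((w ^ ν : Circle) : ℂ) * ((w ^ (-ν) : Circle) : ℂ) = 1 := fun w => by
      rw [← Circle.coe_mul, ← zpow_add, add_neg_cancel, zpow_zero, Circle.coe_one]
    let e : ℂ × Circle ≃ₜ ℂ × Circle :=
      { toFun x := (x.1 * ((x.2 ^ ν : Circle) : ℂ), x.2)
        invFun x := (x.1 * ((x.2 ^ (-ν) : Circle) : ℂ), x.2)
        left_inv x := by simp only [mul_assoc, hinv, mul_one]
        right_inv x := by
          simp only [mul_assoc, mul_comm ((x.2 ^ (-ν) : Circle) : ℂ), hinv, mul_one]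
        continuous_toFun := (continuous_fst.mul (hc _)).prodMk continuous_snd
        continuous_invFun := (continuous_fst.mul (hc _)).prodMk continuous_snd }
    have h1 : fibredSolidTorusProj α ν = Prod.fst ∘ e ∘ Prod.map (· ^ α) id := rfl
    rw [h1]
    exact isOpenMap_fst.comp (e.isOpenMap.comp
      ((Complex.isOpenQuotientMap_pow α).isOpenMap.prodMap IsOpenMap.id))
  · intro z
    obtain ⟨w, hw⟩ := (Complex.isOpenQuotientMap_pow α).surjective z
    exact ⟨(w, 1), by simpa [fibredSolidTorusProj] using hw⟩

theorem fibredSolidTorusProj_mul (α : ℕ) (ν : ℤ) (u v w : Circle) (z : ℂ) :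
    fibredSolidTorusProj α ν (u * z, v * w) =
      (u ^ (α : ℤ) * v ^ ν : Circle) * fibredSolidTorusProj α ν (z, w) := by
  simp only [fibredSolidTorusProj, mul_pow, mul_zpow, Circle.coe_mul, zpow_natCast, Circle.coe_pow]
  ring

theorem fibredSolidTorusProj_isPreconnected_fiber {α : ℕ} {ν : ℤ} (hα : 0 < α)
    (hαν : IsCoprime (α : ℤ) ν) (c : ℂ) : IsPreconnected (fibredSolidTorusProj α ν ⁻¹' {c}) := by
  refine isPreconnected_of_forall_pair fun x hx y hy => ?_
  obtain ⟨z, w⟩ := x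
  obtain ⟨z', w'⟩ := y
  rw [Set.mem_preimage, Set.mem_singleton_iff] at hx hy
  by_cases hz : z = 0
  · -- Both points lie on the core.
    subst hz
    have hc : c = 0 := by rw [← hx, fibredSolidTorusProj, zero_pow hα.ne', zero_mul]
    have hz' : z' = 0 := by
      rw [fibredSolidTorusProj, hc, mul_eq_zero] at hy
      exact eq_zero_of_pow_eq_zero (hy.resolve_right (Circle.coe_ne_zero _))
    refine ⟨Set.range fun s : Circle => ((0 : ℂ), s), ?_, ⟨w, rfl⟩, ⟨w', by rw [hz']⟩,
      isPreconnected_range (by fun_prop)⟩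
    rintro _ ⟨s, rfl⟩
    simp [fibredSolidTorusProj, hα.ne', hc]
  -- Otherwise the fibre is an orbit of the circle action `t • (z, w) = (t ^ (-ν) * z, t ^ α * w)`.
  obtain ⟨u, rfl⟩ : ∃ u : Circle, z' = u * z := by
    have hn : ‖z'‖ = ‖z‖ := by
      refine (pow_left_inj₀ (norm_nonneg _) (norm_nonneg _) hα.ne').1 ?_
      simpa [fibredSolidTorusProj, Circle.norm_coe] using congrArg norm (hy.trans hx.symm)
    exact ⟨⟨z' / z, by simp [Submonoid.unitSphere, hn, hz]⟩, (div_mul_cancel₀ z' hz).symm⟩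
  obtain ⟨v, rfl⟩ : ∃ v : Circle, w' = v * w := ⟨w' / w, by simp⟩
  have huv : u ^ (α : ℤ) * v ^ ν = 1 := by
    have h1 := hy.trans hx.symm
    have h2 : fibredSolidTorusProj α ν (z, w) ≠ 0 :=
      mul_ne_zero (pow_ne_zero _ hz) (Circle.coe_ne_zero _)
    rw [fibredSolidTorusProj_mul, mul_eq_right₀ h2] at h1
    exact Circle.ext h1
  obtain ⟨a, b, hab⟩ := hαν
  obtain ⟨t, ht1, ht2⟩ : ∃ t : Circle, t ^ (-ν) = u ∧ t ^ (α : ℤ) = v := by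
    refine ⟨u ^ (-b) * v ^ a, ?_, ?_⟩
    · calc (u ^ (-b) * v ^ a) ^ (-ν) = u ^ (b * ν) * (v ^ ν) ^ (-a) := by
            rw [mul_zpow, ← zpow_mul, ← zpow_mul, ← zpow_mul]
            congr 2 <;> ring
        _ = u ^ (b * ν) * u ^ (a * α) := by
            rw [eq_inv_of_mul_eq_one_right huv, inv_zpow', neg_neg, ← zpow_mul, mul_comm a]
        _ = u := by rw [← zpow_add, add_comm, hab, zpow_one]
    · calc (u ^ (-b) * v ^ a) ^ (α : ℤ) = (u ^ (α : ℤ)) ^ (-b) * v ^ (a * α) := by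
            rw [mul_zpow, ← zpow_mul, ← zpow_mul, ← zpow_mul, mul_comm (-b)]
        _ = v ^ (b * ν) * v ^ (a * α) := by
            rw [eq_inv_of_mul_eq_one_left huv, inv_zpow', neg_neg, ← zpow_mul, mul_comm b]
        _ = v := by rw [← zpow_add, add_comm, hab, zpow_one]
  subst ht1 ht2
  refine ⟨Set.range fun s : Circle => (((s ^ (-ν) : Circle) : ℂ) * z, s ^ (α : ℤ) * w), ?_,
    ⟨1, by simp⟩, ⟨t, rfl⟩, isPreconnected_range
      (((Circle.continuous_coe_zpow _).mul continuous_const).prodMk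
        ((continuous_zpow _).mul continuous_const))⟩
  rintro _ ⟨s, rfl⟩
  have h1 : (s ^ (-ν)) ^ (α : ℤ) * (s ^ (α : ℤ)) ^ ν = 1 := by
    rw [← zpow_mul, ← zpow_mul, ← zpow_add, mul_comm (-ν), mul_neg, neg_add_cancel, zpow_zero]
  rw [Set.mem_preimage, Set.mem_singleton_iff, fibredSolidTorusProj_mul, h1, Circle.coe_one,
    one_mul, hx]

/-- The composition of a fibred solid torus with a covering `w ↦ w ^ k` of the circle factor is a
fibred solid torus followed by a power map of the base. -/
theorem fibredSolidTorusProj_zpow {α : ℕ} (hα : 0 < α) (ν k : ℤ) :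
    ∃ (d α' : ℕ) (ν' : ℤ), 0 < d ∧ 0 < α' ∧ IsCoprime (α' : ℤ) ν' ∧
      ∀ z w, fibredSolidTorusProj α ν (z, w ^ k) = fibredSolidTorusProj α' ν' (z, w) ^ d := by
  have hd : 0 < Int.gcd α (k * ν) := Int.gcd_pos_of_ne_zero_left _ (by omega)
  obtain ⟨a, ha⟩ := Int.gcd_dvd_left (a := α) (b := k * ν)
  obtain ⟨b, hb⟩ := Int.gcd_dvd_right (a := α) (b := k * ν)
  have ha0 : 0 < a := by
    by_contra h
    have : (Int.gcd α (k * ν) : ℤ) * a ≤ 0 :=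
      mul_nonpos_of_nonneg_of_nonpos (by positivity) (not_lt.1 h)
    omega
  lift a to ℕ using ha0.le
  refine ⟨_, a, b, hd, by exact_mod_cast ha0, ?_, fun z w => ?_⟩
  · rw [Int.isCoprime_iff_gcd_eq_one]
    have h1 := Int.gcd_mul_left (Int.gcd α (k * ν)) a b
    rw [← ha, ← hb] at h1
    simpa [hd.ne'] using h1.symm
  · have ha' : α = a * Int.gcd α (k * ν) := by
      have : (α : ℤ) = ((a * Int.gcd α (k * ν) : ℕ) : ℤ) := by push_cast; rw [mul_comm]; exact ha
      exact_mod_cast this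
    rw [fibredSolidTorusProj, fibredSolidTorusProj, mul_pow, ← pow_mul, ← ha', ← Circle.coe_pow,
      ← zpow_mul, ← zpow_natCast (w ^ b), ← zpow_mul, mul_comm b, ← hb]

/-! ### Finite coverings of Seifert manifolds -/

/-- A point of a manifold has arbitrarily small open neighbourhoods that are contractible and
locally path connected, on the boundary as well. -/
theorem IsTopologicalManifold.exists_contractible_nhd {n : ℕ} [NeZero n] {F : Type u}
    [TopologicalSpace F] (hF : IsTopologicalManifold n F) {O : Set F} (hO : IsOpen O) {b : F}
    (hb : b ∈ O) : ∃ U ⊆ O, IsOpen U ∧ b ∈ U ∧ ContractibleSpace U ∧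
      LocallyPathConnectedSpace U := by
  obtain ⟨c, hc⟩ := hF.exists_chart b
  have ho : IsOpen (c.target ∩ c.symm ⁻¹' O) := c.isOpen_inter_preimage_symm hO
  obtain ⟨o, ho1, ho2⟩ := isOpen_induced_iff.1 ho
  have hcb : (c b).1 ∈ o := by
    have : c b ∈ Subtype.val ⁻¹' o := by
      rw [ho2]
      exact ⟨c.map_source hc, by rwa [Set.mem_preimage, c.left_inv hc]⟩
    exact this
  obtain ⟨ε, hε, hball⟩ := Metric.isOpen_iff.1 ho1 _ hcb
  let B : Set (EuclideanHalfSpace n) := Subtype.val ⁻¹' Metric.ball (c b).1 ε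
  have hBo : IsOpen B := Metric.isOpen_ball.preimage continuous_subtype_val
  have hB : B ⊆ c.target ∩ c.symm ⁻¹' O := by
    rw [← ho2]
    exact Set.preimage_mono hball
  have hbB : c b ∈ B := Metric.mem_ball_self hε
  have h1 : ContractibleSpace B := by
    have hconv : Convex ℝ (Subtype.val '' B) := by
      have : Subtype.val '' B = Metric.ball (c b).1 ε ∩
          { x : EuclideanSpace ℝ (Fin n) | 0 ≤ x 0 } := by
        ext x
        exact ⟨by rintro ⟨y, hy, rfl⟩; exact ⟨hy, y.2⟩, fun hx => ⟨⟨x, hx.2⟩, hx.1, rfl⟩⟩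
      rw [this]
      exact (convex_ball _ _).inter EuclideanHalfSpace.convex
    have := hconv.contractibleSpace ⟨_, _, hbB, rfl⟩
    exact (IsEmbedding.subtypeVal.homeomorphImage B).contractibleSpace
  have h2 : LocallyPathConnectedSpace B := hBo.locallyPathConnectedSpace
  let e : B ≃ₜ c.symm '' B :=
    c.symm.homeomorphOfImageSubsetSource (fun x hx => (hB hx).1) rfl
  refine ⟨c.symm '' B, ?_, ?_, ⟨c b, hbB, c.left_inv hc⟩, e.symm.contractibleSpace,
    e.symm.isOpenEmbedding.locallyPathConnectedSpace⟩
  · rintro _ ⟨x, hx, rfl⟩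
    exact (hB hx).2
  · exact c.symm.isOpen_image_of_subset_source hBo fun x hx => (hB hx).1

theorem finite_preimage_restrictPreimage {N N' Z : Type*} [TopologicalSpace N]
    [TopologicalSpace Z] {ρ : N' → N} (hfin : ∀ x, (ρ ⁻¹' {x}).Finite) {S : Set N} (h : S ≃ₜ Z)
    (z : Z) : ((h ∘ S.restrictPreimage ρ) ⁻¹' {z}).Finite := by
  have : ((h ∘ S.restrictPreimage ρ) ⁻¹' {z}) ⊆ Subtype.val ⁻¹' (ρ ⁻¹' {(h.symm z : N)}) := by
    rintro y hy
    have hy' : h (S.restrictPreimage ρ y) = z := hy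
    rw [← Homeomorph.eq_symm_apply] at hy'
    exact congrArg Subtype.val hy'
  exact ((hfin _).preimage Subtype.val_injective.injOn).subset this

/-- The part of a finite covering space of `N` lying over a piece `D × S¹` of `N`, with `D`
contractible, is a union of clopen copies of `D × S¹` on which the covering map is a power map on
the circle factor. -/
theorem exists_covering_piece {N N' D : Type*} [TopologicalSpace N] [TopologicalSpace N']
    [TopologicalSpace D] [ContractibleSpace D] [LocallyPathConnectedSpace D] {ρ : N' → N}
    (hρ : IsCoveringMap ρ) (hfin : ∀ x, (ρ ⁻¹' {x}).Finite) {S : Set N} (hS : IsOpen S)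
    (h : S ≃ₜ D × Circle) {x : N'} (hx : ρ x ∈ S) :
    ∃ (k : ℤ) (W : Set N') (hW : W ⊆ ρ ⁻¹' S) (H : W ≃ₜ D × Circle),
      x ∈ W ∧ IsOpen W ∧ IsOpen (ρ ⁻¹' S \ W) ∧
        ∀ y : W, h ⟨ρ y, hW y.2⟩ = ((H y).1, (H y).2 ^ k) := by
  let h' : S ≃ₜ D × (Fin 1 → Circle) :=
    h.trans ((Homeomorph.refl D).prodCongr (Homeomorph.funUnique (Fin 1) Circle).symm)
  have hcov : IsCoveringMap (h' ∘ S.restrictPreimage ρ) :=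
    (hρ.restrictPreimage S).homeomorph_comp h'
  obtain ⟨A, W, ψ, hW, hxW, hψ⟩ := hcov.exists_clopen_homeomorph_torus
    (finite_preimage_restrictPreimage hfin h') ⟨x, hx⟩
  have hpo : IsOpen (ρ ⁻¹' S) := hS.preimage hρ.continuous
  have hval := hpo.isOpenMap_subtype_val
  let H : (Subtype.val '' W : Set N') ≃ₜ D × Circle :=
    (IsEmbedding.subtypeVal.homeomorphImage W).symm.trans (ψ.symm.trans
      ((Homeomorph.refl D).prodCongr (Homeomorph.funUnique (Fin 1) Circle)))
  refine ⟨A 0 0, Subtype.val '' W, by rintro _ ⟨y, -, rfl⟩; exact y.2, H, ⟨_, hxW, rfl⟩,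
    hval _ hW.isOpen, ?_, ?_⟩
  · convert! hval _ hW.compl.isOpen using 1
    rw [Set.image_compl_eq_range_sdiff_image Subtype.val_injective, Subtype.range_val]
  · rintro ⟨_, y, hy, rfl⟩
    obtain ⟨⟨d, w⟩, hdw⟩ := ψ.surjective ⟨y, hy⟩
    have h1 : H ⟨y, y, hy, rfl⟩ = (d, w 0) := by
      have : (IsEmbedding.subtypeVal.homeomorphImage W).symm ⟨y, y, hy, rfl⟩ = ψ (d, w) := by
        rw [Homeomorph.symm_apply_eq, hdw]
        rfl
      simp only [H, Homeomorph.trans_apply, this, Homeomorph.symm_apply_apply]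
      rfl
    have h2 := hψ d w
    rw [hdw] at h2
    have h3 : h (S.restrictPreimage ρ y) = (d, (w 0) ^ A 0 0) := by
      have := congrArg (fun z : D × (Fin 1 → Circle) => (z.1, z.2 0)) h2
      simpa [h'] using this
    rw [h1]
    exact h3

/-- Leaf charts of a map that is given on an open set `W`, homeomorphic to `D × S¹`, by a model map
with connected fibres followed by a map with finite fibres. -/
theorem IsLeafChart.of_model {X F D : Type*} [TopologicalSpace X] [TopologicalSpace D]
    [ConnectedSpace D] {P : X → F} {U : Set F} {W : Set X} (hW : IsOpen W) (hWU : W ⊆ P ⁻¹' U)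
    (hdiff : IsOpen (P ⁻¹' U \ W)) (H : W ≃ₜ D × Circle) {D' : Type*} [TopologicalSpace D']
    {μ : D × Circle → D'} (hμ : IsQuotientMap μ)
    (hfib : ∀ d, IsPreconnected (μ ⁻¹' {d})) {r : D' → F} (hr : ∀ b, (r ⁻¹' {b}).Finite)
    (hP : ∀ x : W, P x = r (μ (H x))) : IsLeafChart P U W (μ ∘ H) r where
  isOpen := hW
  isPreconnected := by
    have h : Set.range (Subtype.val ∘ H.symm) = W := by
      rw [H.symm.surjective.range_comp, Subtype.range_val]
    exact h ▸ isPreconnected_range (continuous_subtype_val.comp H.symm.continuous)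
  subset := hWU
  isOpen_diff := hdiff
  isQuotientMap := hμ.comp H.isQuotientMap
  isPreconnected_fiber d := by
    rw [Set.preimage_comp, ← Homeomorph.image_symm]
    exact ((hfib d).image _ H.symm.continuous.continuousOn).image _
      continuous_subtype_val.continuousOn
  factor := hP
  finite := hr

/-- A finite covering of the total space of a Seifert fibration has leaf charts over the base. -/
theorem hasLeafCharts_comp {N N' F : Type u} [TopologicalSpace N] [TopologicalSpace N']
    [TopologicalSpace F] {p : N → F} (hp : Continuous p) (hF : IsTopologicalManifold 2 F)
    {ρ : N' → N} (hρ : IsCoveringMap ρ) (hfin : ∀ x, (ρ ⁻¹' {x}).Finite) {E : Set F}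
    (hreg : ∀ b ∉ E, ∃ e : Bundle.Trivialization Circle p, b ∈ e.baseSet)
    (hexc : ∀ b ∈ E, IsFibredSolidTorusAt p b) (b : F) : HasLeafCharts (p ∘ ρ) E b := by
  by_cases hb : b ∈ E
  · obtain ⟨α, ν, hα, -, U, hbU, g, h, hUo, hg, hgh⟩ := hexc b hb
    refine ⟨U, hUo, hbU, fun x hx => ?_⟩
    obtain ⟨k, W, hW, H, hxW, hWo, hWd, hH⟩ :=
      exists_covering_piece hρ hfin (hUo.preimage hp) h hx
    obtain ⟨d, α', ν', hd, hα', hαν', hk⟩ := fibredSolidTorusProj_zpow hα ν k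
    have hfac : ∀ y : W, g ⟨p (ρ y), hW y.2⟩ = fibredSolidTorusProj α' ν' (H y) ^ d := by
      intro y
      rw [hgh ⟨ρ y, hW y.2⟩, hH, hk]
    have hμ : IsQuotientMap (g.symm ∘ fibredSolidTorusProj α' ν') :=
      g.symm.isQuotientMap.comp (fibredSolidTorusProj_isQuotientMap hα' ν')
    refine ⟨W, _, fun c => (g.symm (g c ^ d) : F), hxW,
      IsLeafChart.of_model (P := p ∘ ρ) (U := U) hWo hW hWd H hμ
        (fun c => ?_) (fun a => ?_) fun y => ?_,
      fun h => absurd hb h, fun _ hxb => ⟨α', ν', hα', hαν', g, H, ?_, fun y => by simp⟩⟩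
    · rw [Set.preimage_comp, ← Homeomorph.image_eq_preimage_symm, Set.image_singleton]
      exact fibredSolidTorusProj_isPreconnected_fiber hα' hαν' _
    · by_cases ha : a ∈ U
      · have hroots : {z : ℂ | z ^ d = g ⟨a, ha⟩}.Finite := by
          refine (Polynomial.nthRoots d (g ⟨a, ha⟩)).toFinset.finite_toSet.subset fun z hz => ?_
          simpa [Polynomial.mem_nthRoots hd] using hz
        refine (hroots.preimage g.injective.injOn).subset fun c hc => ?_
        have : g.symm (g c ^ d) = ⟨a, ha⟩ := Subtype.ext hc
        rwa [Homeomorph.symm_apply_eq] at this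
      · refine Set.finite_empty.subset fun c hc => ha ?_
        rw [← show (g.symm (g c ^ d) : F) = a from hc]
        exact Subtype.property _
    · simp only [Function.comp_apply, Homeomorph.apply_symm_apply, ← hfac,
        Homeomorph.symm_apply_apply]
    · have h1 := hfac ⟨x, hxW⟩
      have h2 : (⟨p (ρ x), hW hxW⟩ : U) = ⟨b, hbU⟩ := Subtype.ext hxb
      rw [h2, hg] at h1
      simpa using eq_zero_of_pow_eq_zero h1.symm
  · obtain ⟨e, he⟩ := hreg b hb
    obtain ⟨U, hUe, hUo, hbU, hc, hl⟩ := hF.exists_contractible_nhd e.open_baseSet he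
    refine ⟨U, hUo, hbU, fun x hx => ?_⟩
    obtain ⟨k, W, hW, H, hxW, hWo, hWd, hH⟩ :=
      exists_covering_piece hρ hfin (hUo.preimage hp) (e.preimageHomeomorph hUe) hx
    refine ⟨W, _, Subtype.val, hxW, IsLeafChart.of_model (P := p ∘ ρ) (U := U) hWo hW hWd H
      (isQuotientMap_fst (X := U) (Y := Circle)) (fun c => ?_) (fun a => ?_) fun y => ?_,
      fun _ => ⟨H, fun y => rfl⟩, fun h => absurd h hb⟩
    · have : Prod.fst ⁻¹' {c} = Set.range fun w : Circle => (c, w) := by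
        ext ⟨c', w⟩
        simp [eq_comm]
      rw [this]
      exact isPreconnected_range (by fun_prop)
    · exact (Set.finite_singleton a).preimage Subtype.val_injective.injOn
    · have := congrArg (fun z => (z.1 : F)) (hH y)
      simpa using this

/-- A compact finite covering space of a Seifert manifold is a Seifert manifold: it is fibred over
the leaf space of its map to the base. -/
theorem IsSeifertManifold.of_isCoveringMap {N N' : Type u} [TopologicalSpace N]
    [TopologicalSpace N'] [T2Space N'] [CompactSpace N'] (hN : IsSeifertManifold N) {ρ : N' → N}
    (hρ : IsCoveringMap ρ) (hfin : ∀ x, (ρ ⁻¹' {x}).Finite) : IsSeifertManifold N' := by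
  obtain ⟨F, _, p, hp⟩ := hN
  obtain ⟨E, hE, hreg, hexc⟩ := hp.exists_special
  have := hp.compact_base
  exact ⟨LeafSpace (p ∘ ρ), inferInstance, _, isSeifertFibration_toLeaf
    (.of_compactSpace fun x => hρ.isLocalHomeomorph.exists_chart (hp.manifold_total.exists_chart _))
    inferInstance hp.manifold_base (hp.continuous_proj.comp hρ.continuous) hE
    (hasLeafCharts_comp hp.continuous_proj hp.manifold_base hρ hfin hreg hexc)⟩

end ThreeManifold

/-! ### Finite coverings and their pullbacks -/

section Pullback

variable {M M' N : Type*} [TopologicalSpace M] [TopologicalSpace M'] [TopologicalSpace N]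

theorem IsCoveringMap.t2Space [T2Space M] {π : M' → M} (hπ : IsCoveringMap π) : T2Space M' := by
  refine ⟨fun x y hxy => ?_⟩
  by_cases h : π x = π y
  · exact hπ.isSeparatedMap x y h hxy
  · obtain ⟨s, t, hs, ht, hxs, hyt, hst⟩ := t2_separation h
    exact ⟨_, _, hs.preimage hπ.continuous, ht.preimage hπ.continuous, hxs, hyt, hst.preimage _⟩

theorem IsCoveringMap.compactSpace_of_finite [T2Space M] [CompactSpace M] {π : M' → M}
    (hπ : IsCoveringMap π) (hfin : ∀ x, (π ⁻¹' {x}).Finite) : CompactSpace M' := by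
  have h : ∀ x : M, ∃ K ∈ 𝓝 x, IsCompact (π ⁻¹' K) := by
    intro x
    obtain ⟨hd, U, hxU, hU, -, H, hH⟩ := hπ x
    obtain ⟨K, hK, hKU, hKc⟩ := local_compact_nhds (hU.mem_nhds hxU)
    refine ⟨K, hK, ?_⟩
    have : Finite (π ⁻¹' {x}) := hfin x
    have hKc' : IsCompact (Subtype.val ⁻¹' K : Set U) :=
      hU.isOpenEmbedding_subtypeVal.isInducing.isCompact_preimage' hKc (by simpa using hKU)
    convert ((hKc'.prod (isCompact_univ (X := π ⁻¹' {x}))).image H.symm.continuous).image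
      continuous_subtype_val using 1
    ext y
    constructor
    · intro hy
      refine ⟨⟨y, hKU hy⟩, ⟨H ⟨y, hKU hy⟩, ⟨?_, trivial⟩, by simp⟩, rfl⟩
      rw [Set.mem_preimage, hH]
      exact hy
    · rintro ⟨_, ⟨z, ⟨hz, -⟩, rfl⟩, rfl⟩
      rw [Set.mem_preimage, ← hH, Homeomorph.apply_symm_apply]
      exact hz
  choose K hK hKc using h
  obtain ⟨t, ht⟩ := isCompact_univ.elim_nhds_subcover K fun x _ => hK x
  refine ⟨(t.isCompact_biUnion fun x _ => hKc x).of_isClosed_subset isClosed_univ fun y _ => ?_⟩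
  obtain ⟨x, hx, hy⟩ := Set.mem_iUnion₂.1 (ht.2 (Set.mem_univ (π y)))
  exact Set.mem_iUnion₂.2 ⟨x, hx, hy⟩

/-- The projection of a pullback of a local homeomorphism is a local homeomorphism. -/
theorem IsLocalHomeomorph.pullback_snd {π : M' → M} (hπ : IsLocalHomeomorph π) {q : N → M}
    (hq : Continuous q) :
    IsLocalHomeomorph (fun z : {z : M' × N // π z.1 = q z.2} => z.1.2) := by
  rw [isLocalHomeomorph_iff_isOpenEmbedding_restrict]
  rintro ⟨⟨m, n⟩, hmn⟩
  obtain ⟨φ, hm, rfl⟩ := hπ m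
  let S : Set {z : M' × N // φ z.1 = q z.2} := {z | z.1.1 ∈ φ.source}
  have hS : IsOpen S := φ.open_source.preimage (by fun_prop)
  have hT : IsOpen (q ⁻¹' φ.target) := φ.open_target.preimage hq
  refine ⟨S, hS.mem_nhds hm, ?_⟩
  let e : S ≃ₜ q ⁻¹' φ.target :=
    { toFun z := ⟨z.1.1.2, by
        rw [Set.mem_preimage, ← z.1.2]
        exact φ.map_source z.2⟩
      invFun n := ⟨⟨(φ.symm (q n), n), φ.right_inv n.2⟩, φ.map_target n.2⟩
      left_inv z := by
        refine Subtype.ext (Subtype.ext (Prod.ext ?_ rfl))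
        show φ.symm (q z.1.1.2) = z.1.1.1
        rw [← z.1.2]
        exact φ.left_inv z.2
      right_inv n := rfl
      continuous_toFun := by fun_prop
      continuous_invFun := by
        have : Continuous fun n : q ⁻¹' φ.target => φ.symm (q n) :=
          φ.continuousOn_symm.comp_continuous (by fun_prop) fun n => n.2
        fun_prop }
  exact hT.isOpenEmbedding_subtypeVal.comp e.isOpenEmbedding

end Pullback

namespace ThreeManifold

/-! ### Coverings of boundary tori -/

section BoundaryTorus

variable {N N' : Type u} [TopologicalSpace N] [TopologicalSpace N'] {ρ : N' → N} {T : Set N}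

theorem IsBoundaryTorus.isConnected (hT : IsBoundaryTorus T) : IsConnected T := by
  obtain ⟨⟨x, hx, rfl⟩, -⟩ := hT
  exact isConnected_connectedComponentIn_iff.2 hx

/-- A connected component of the preimage of a boundary torus under a finite covering is a boundary
torus. -/
theorem IsBoundaryTorus.image_connectedComponent (hT : IsBoundaryTorus T) (hρ : IsCoveringMap ρ)
    (hfin : ∀ x, (ρ ⁻¹' {x}).Finite) (x : ρ ⁻¹' T) :
    IsBoundaryTorus (Subtype.val '' connectedComponent x) := by
  obtain ⟨⟨x₀, hx₀, hT₀⟩, ⟨h⟩⟩ := hT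
  have hTbd : T ⊆ manifoldBoundary 3 N := hT₀ ▸ connectedComponentIn_subset _ _
  have hbd := hρ.isLocalHomeomorph.preimage_manifoldBoundary (n := 3)
  have hxbd : (x : N') ∈ manifoldBoundary 3 N' := hbd ▸ hTbd x.2
  refine ⟨⟨x, hxbd, ?_⟩, ?_⟩
  · rw [← connectedComponentIn_eq_image x.2]
    refine (connectedComponentIn_mono _ (hbd ▸ Set.preimage_mono hTbd)).antisymm ?_
    refine isPreconnected_connectedComponentIn.subset_connectedComponentIn
      (mem_connectedComponentIn hxbd) ?_
    have hx1 : ρ x ∈ connectedComponentIn (manifoldBoundary 3 N) x₀ := hT₀ ▸ x.2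
    rw [← Set.image_subset_iff]
    refine Set.Subset.trans ?_ (hT₀.trans (connectedComponentIn_eq hx1)).ge
    refine (isPreconnected_connectedComponentIn.image ρ
      hρ.continuous.continuousOn).subset_connectedComponentIn
      ⟨x, mem_connectedComponentIn hxbd, rfl⟩ ?_
    rw [Set.image_subset_iff, hbd]
    exact connectedComponentIn_subset _ _
  · let h' : T ≃ₜ PUnit.{1} × (Fin 2 → Circle) :=
      h.trans (Homeomorph.finTwoArrow.symm.trans (Homeomorph.punitProd _).symm)
    have hcov : IsCoveringMap (h' ∘ T.restrictPreimage ρ) :=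
      (hρ.restrictPreimage T).homeomorph_comp h'
    obtain ⟨A, W, ψ, hW, hxW, -⟩ :=
      hcov.exists_clopen_homeomorph_torus (finite_preimage_restrictPreimage hfin h') x
    have hWc : IsPreconnected W := by
      have h : Set.range (Subtype.val ∘ ψ) = W := by
        rw [ψ.surjective.range_comp, Subtype.range_val]
      exact h ▸ isPreconnected_range (continuous_subtype_val.comp ψ.continuous)
    have hWeq : connectedComponent x = W :=
      (hW.connectedComponent_subset hxW).antisymm (hWc.subset_connectedComponent hxW)
    rw [hWeq]
    exact ⟨(IsEmbedding.subtypeVal.homeomorphImage W).symm.trans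
      (ψ.symm.trans ((Homeomorph.punitProd _).trans Homeomorph.finTwoArrow))⟩

theorem IsBoundaryTorus.finite_connectedComponents [T2Space N] [CompactSpace N']
    (hT : IsBoundaryTorus T) (hρ : IsCoveringMap ρ) (hfin : ∀ x, (ρ ⁻¹' {x}).Finite) :
    Finite (ConnectedComponents (ρ ⁻¹' T)) := by
  have : ConnectedSpace T := isConnected_iff_connectedSpace.1 hT.isConnected
  have hc := hρ.restrictPreimage T
  refine IsOpenMap.finite_connectedComponents_of_finite_preimage_singleton hc.isOpenMap
    (hρ.continuous.isClosedMap.restrictPreimage T) hc.continuous fun y => ?_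
  refine ((hfin y).preimage Subtype.val_injective.injOn).subset ?_
  intro z hz
  exact congrArg Subtype.val hz

end BoundaryTorus

/-! ### Lifting a gluing -/

/-- Gluing data indexed by an arbitrary finite type. -/
def TorusGluing.ofFinite {N : Type u} [TopologicalSpace N] {J : Type*} [Finite J]
    (left right : J → Set N) (hl : ∀ j, IsBoundaryTorus (left j))
    (hr : ∀ j, IsBoundaryTorus (right j)) (hll : Pairwise fun i j => Disjoint (left i) (left j))
    (hrr : Pairwise fun i j => Disjoint (right i) (right j))
    (hlr : ∀ i j, Disjoint (left i) (right j)) (glue : ∀ j, left j ≃ₜ right j) :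
    TorusGluing N where
  numPairs := Nat.card J
  left i := left ((Finite.equivFin J).symm i)
  right i := right ((Finite.equivFin J).symm i)
  isBoundaryTorus_left _ := hl _
  isBoundaryTorus_right _ := hr _
  pairwise_disjoint := by
    rintro (a | a) (b | b) hab
    · exact hll fun h => hab (congrArg Sum.inl ((Finite.equivFin J).symm.injective h))
    · exact hlr _ _
    · exact (hlr _ _).symm
    · exact hrr fun h => hab (congrArg Sum.inr ((Finite.equivFin J).symm.injective h))
  glue i := glue _

theorem TorusGluing.ofFinite_rel {N : Type u} [TopologicalSpace N] {J : Type*} [Finite J]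
    {left right : J → Set N} {hl : ∀ j, IsBoundaryTorus (left j)}
    {hr : ∀ j, IsBoundaryTorus (right j)} {hll : Pairwise fun i j => Disjoint (left i) (left j)}
    {hrr : Pairwise fun i j => Disjoint (right i) (right j)}
    {hlr : ∀ i j, Disjoint (left i) (right j)} {glue : ∀ j, left j ≃ₜ right j} {x y : N} :
    (TorusGluing.ofFinite left right hl hr hll hrr hlr glue).Rel x y ↔
      x = y ∨ ∃ (j : J) (a : left j), (x = a ∧ y = glue j a) ∨ (y = a ∧ x = glue j a) := by
  refine or_congr Iff.rfl ?_
  refine ⟨fun ⟨i, h⟩ => ⟨_, h⟩, fun ⟨j, h⟩ => ?_⟩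
  obtain ⟨i, rfl⟩ := (Finite.equivFin J).symm.surjective j
  exact ⟨i, h⟩

section Lift

variable {M M' N : Type u} [TopologicalSpace M'] [TopologicalSpace N]

/-- A gluing of `N` lifts along the pullback of a covering `π : M' → M` of the glued manifold `M`:
over a pair of glued tori, the gluing homeomorphism lifts to a homeomorphism of the preimages. -/
def TorusGluing.pullbackGlue (G : TorusGluing N) {π : M' → M} {q : N → M}
    (hq : ∀ x y : N, q x = q y ↔ G.Rel x y) (i : Fin G.numPairs) :
    ((fun z : {z : M' × N // π z.1 = q z.2} => z.1.2) ⁻¹' G.left i) ≃ₜ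
      ((fun z : {z : M' × N // π z.1 = q z.2} => z.1.2) ⁻¹' G.right i) where
  toFun z := ⟨⟨(z.1.1.1, G.glue i ⟨z.1.1.2, z.2⟩), by
    rw [z.1.2]
    exact (hq _ _).2 (Or.inr ⟨i, ⟨z.1.1.2, z.2⟩, Or.inl ⟨rfl, rfl⟩⟩)⟩, (G.glue i _).2⟩
  invFun z := ⟨⟨(z.1.1.1, (G.glue i).symm ⟨z.1.1.2, z.2⟩), by
    rw [z.1.2]
    exact (hq _ _).2 (Or.inr ⟨i, (G.glue i).symm ⟨z.1.1.2, z.2⟩, Or.inr ⟨rfl, by simp⟩⟩)⟩,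
    ((G.glue i).symm _).2⟩
  left_inv z := by simp
  right_inv z := by simp
  continuous_toFun := by fun_prop
  continuous_invFun := by fun_prop

/-- If `M` is obtained from `N` by a gluing, a finite covering `M'` of `M` is obtained by a gluing
from the pulled back covering of `N`. -/
theorem TorusGluing.exists_pullback (G : TorusGluing N) [T2Space N]
    {π : M' → M} {q : N → M} (hq : ∀ x y : N, q x = q y ↔ G.Rel x y)
    [CompactSpace {z : M' × N // π z.1 = q z.2}]
    (hρ : IsCoveringMap fun z : {z : M' × N // π z.1 = q z.2} => z.1.2)
    (hfin : ∀ n, ((fun z : {z : M' × N // π z.1 = q z.2} => z.1.2) ⁻¹' {n}).Finite) :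
    ∃ G' : TorusGluing {z : M' × N // π z.1 = q z.2},
      ∀ z w, z.1.1 = w.1.1 ↔ G'.Rel z w := by
  set ρ : {z : M' × N // π z.1 = q z.2} → N := fun z => z.1.2
  let g := fun i => G.pullbackGlue (π := π) hq i
  -- One pair of tori for each component of the preimage of the left torus of each pair of `G`.
  let J := Σ i, ConnectedComponents (ρ ⁻¹' G.left i)
  have : ∀ i, Finite (ConnectedComponents (ρ ⁻¹' G.left i)) := fun i =>
    (G.isBoundaryTorus_left i).finite_connectedComponents hρ hfin
  let A : (j : J) → Set (ρ ⁻¹' G.left j.1) := fun j => ConnectedComponents.mk ⁻¹' {j.2}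
  let left : J → Set {z : M' × N // π z.1 = q z.2} := fun j => Subtype.val '' A j
  let right : J → Set {z : M' × N // π z.1 = q z.2} := fun j => Subtype.val '' (g j.1 '' A j)
  have hleft : ∀ j, left j ⊆ ρ ⁻¹' G.left j.1 := by
    rintro j _ ⟨z, -, rfl⟩
    exact z.2
  have hright : ∀ j, right j ⊆ ρ ⁻¹' G.right j.1 := by
    rintro j _ ⟨z, -, rfl⟩
    exact z.2
  have hA : ∀ i c c', c ≠ c' → Disjoint (A ⟨i, c⟩) (A ⟨i, c'⟩) := fun i c c' h =>
    (Set.disjoint_singleton.2 h).preimage _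
  have hpd := G.pairwise_disjoint
  let glue : ∀ j, left j ≃ₜ right j := fun j =>
    (IsEmbedding.subtypeVal.homeomorphImage _).symm.trans
      (((g j.1).image (A j)).trans (IsEmbedding.subtypeVal.homeomorphImage _))
  refine ⟨TorusGluing.ofFinite left right ?_ ?_ ?_ ?_ ?_ glue, ?_⟩
  · rintro ⟨i, c⟩
    obtain ⟨x, rfl⟩ := ConnectedComponents.surjective_coe c
    simp only [left, A, connectedComponents_preimage_singleton]
    exact (G.isBoundaryTorus_left i).image_connectedComponent hρ hfin x
  · rintro ⟨i, c⟩
    obtain ⟨x, rfl⟩ := ConnectedComponents.surjective_coe c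
    simp only [right, A, connectedComponents_preimage_singleton]
    have : g i '' connectedComponent x = connectedComponent (g i x) := by
      simpa [connectedComponentIn_univ] using (g i).image_connectedComponentIn (Set.mem_univ x)
    rw [this]
    exact (G.isBoundaryTorus_right i).image_connectedComponent hρ hfin _
  · rintro ⟨i, c⟩ ⟨i', c'⟩ h
    by_cases hi : i = i'
    · subst hi
      exact Set.disjoint_image_of_injective Subtype.val_injective
        (hA i c c' fun hc => h (by rw [hc]))
    · exact ((hpd (i := Sum.inl i) (j := Sum.inl i') (by simpa using hi)).preimage ρ).mono
        (hleft _) (hleft _)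
  · rintro ⟨i, c⟩ ⟨i', c'⟩ h
    by_cases hi : i = i'
    · subst hi
      exact Set.disjoint_image_of_injective Subtype.val_injective
        (Set.disjoint_image_of_injective (g i).injective (hA i c c' fun hc => h (by rw [hc])))
    · exact ((hpd (i := Sum.inr i) (j := Sum.inr i') (by simpa using hi)).preimage ρ).mono
        (hright _) (hright _)
  · rintro ⟨i, c⟩ ⟨i', c'⟩
    exact ((hpd (i := Sum.inl i) (j := Sum.inr i') (by simp)).preimage ρ).mono
        (hleft _) (hright _)
  · have hglue : ∀ (j : J) (a : A j),
        (glue j (⟨a, a, a.2, rfl⟩ : left j)).1 = g j.1 a := by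
      intro j a
      have : (IsEmbedding.subtypeVal.homeomorphImage (A j)).symm ⟨a, a, a.2, rfl⟩ = a := by
        rw [Homeomorph.symm_apply_eq]
        rfl
      simp only [glue, Homeomorph.trans_apply, this]
      rfl
    intro z w
    refine Iff.trans ?_ TorusGluing.ofFinite_rel.symm
    constructor
    · intro hzw
      have hqq : q z.1.2 = q w.1.2 := by rw [← z.2, ← w.2, hzw]
      rcases (hq _ _).1 hqq with h | ⟨i, a, ⟨h1, h2⟩ | ⟨h1, h2⟩⟩
      · exact Or.inl (Subtype.ext (Prod.ext hzw h))
      · have hz : z ∈ ρ ⁻¹' G.left i := by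
          show z.1.2 ∈ G.left i
          rw [h1]
          exact a.2
        refine Or.inr ⟨⟨i, (⟨z, hz⟩ : ρ ⁻¹' G.left i)⟩, ⟨z, ⟨z, hz⟩, rfl, rfl⟩, Or.inl ⟨rfl, ?_⟩⟩
        refine Eq.trans ?_ (hglue ⟨i, (⟨z, hz⟩ : ρ ⁻¹' G.left i)⟩ ⟨⟨z, hz⟩, rfl⟩).symm
        refine Subtype.ext (Prod.ext hzw.symm ?_)
        obtain rfl : a = ⟨z.1.2, hz⟩ := Subtype.ext h1.symm
        exact h2
      · have hw : w ∈ ρ ⁻¹' G.left i := by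
          show w.1.2 ∈ G.left i
          rw [h1]
          exact a.2
        refine Or.inr ⟨⟨i, (⟨w, hw⟩ : ρ ⁻¹' G.left i)⟩, ⟨w, ⟨w, hw⟩, rfl, rfl⟩, Or.inr ⟨rfl, ?_⟩⟩
        refine Eq.trans ?_ (hglue ⟨i, (⟨w, hw⟩ : ρ ⁻¹' G.left i)⟩ ⟨⟨w, hw⟩, rfl⟩).symm
        refine Subtype.ext (Prod.ext hzw ?_)
        obtain rfl : a = ⟨w.1.2, hw⟩ := Subtype.ext h1.symm
        exact h2
    · have hfst : ∀ (j : J) (a : left j), (glue j a).1.1.1 = a.1.1.1 := by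
        rintro j ⟨_, a, ha, rfl⟩
        rw [hglue j ⟨a, ha⟩]
        rfl
      rintro (rfl | ⟨j, a, ⟨rfl, rfl⟩ | ⟨rfl, rfl⟩⟩)
      · rfl
      · exact (hfst j a).symm
      · exact hfst j a

end Lift

end ThreeManifold

end

theorem corollary4p2 {M M' : Type u} [TopologicalSpace M] [TopologicalSpace M']
    (π : M' → M) (hπ : IsCoveringMap π) (hfin : ∀ x : M, (π ⁻¹' {x}).Finite)
    (hM : ThreeManifold.IsWaldhausenManifold M) :
    ThreeManifold.IsWaldhausenManifold M' := by
  obtain ⟨hMm, hMc, N, _, G, q, hN, hq, hG⟩ := hM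
  have := hMm.t2
  have : T2Space N := by obtain ⟨F, _, p, hp⟩ := hN; exact hp.manifold_total.t2
  have : CompactSpace N := by obtain ⟨F, _, p, hp⟩ := hN; exact hp.compact_total
  have : T2Space M' := hπ.t2Space
  have : CompactSpace M' := hπ.compactSpace_of_finite hfin
  have : CompactSpace {z : M' × N // π z.1 = q z.2} :=
    isCompact_iff_compactSpace.1 (isClosed_eq (hπ.continuous.comp continuous_fst)
      (hq.continuous.comp continuous_snd)).isCompact
  have hρ := isLocalHomeomorph_iff_isCoveringMap.1
    (hπ.isLocalHomeomorph.pullback_snd hq.continuous)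
  have hρfin : ∀ n, ((fun z : {z : M' × N // π z.1 = q z.2} => z.1.2) ⁻¹' {n}).Finite := by
    intro n
    refine Set.Finite.of_finite_image (f := fun z => z.1.1)
      ((hfin (q n)).subset ?_) ?_
    · rintro _ ⟨z, rfl, rfl⟩
      exact z.2
    · rintro z rfl w hw hzw
      exact Subtype.ext (Prod.ext hzw hw.symm)
  obtain ⟨G', hG'⟩ := G.exists_pullback hG hρ hρfin
  refine ⟨.of_compactSpace fun x => hπ.isLocalHomeomorph.exists_chart (hMm.exists_chart _),
    inferInstance, _, inferInstance, G', fun z => z.1.1, hN.of_isCoveringMap hρ hρfin, ?_, hG'⟩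
  have hc : Continuous fun z : {z : M' × N // π z.1 = q z.2} => z.1.1 := by fun_prop
  refine hc.isClosedMap.isQuotientMap hc fun m => ?_
  obtain ⟨n, hn⟩ := hq.surjective (π m)
  exact ⟨⟨(m, n), hn.symm⟩, rfl⟩
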